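/- For $n\ge 1$ and $a\in\mathbb{C}$, let $J_n(a)$ be the $n\times n$ upper-triangular KMS matrix, whose $(i,j)$ entry is $a^{j-i}$ if $i<j$ and $0$ if $i\ge j$. For an $n\times n$ complex matrix $A$, let $W(A)=\{\langle Ax,x\rangle : x\in\mathbb{C}^n,\ \|x\|=1\}$ be its numerical range, where $\langle\cdot,\cdot\rangle$ is the standard inner product on $\mathbb{C}^n$ and $\|\cdot\|$ its associated norm. If $n\ge 2$ and $a,b\in\mathbb{C}$ satisfy $|a|<|b|$, then $W(J_n(a))$ is contained in the interior (in $\mathbb{C}$) of $W(J_n(b))$. -/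

import Mathlib

/-- The upper-triangular KMS matrix `J_n(a)`: its `(i, j)` entry is `a ^ (j - i)` above the
diagonal (`i < j`) and `0` on and below the diagonal. -/
def kmsMatrix (n : ℕ) (a : ℂ) : Matrix (Fin n) (Fin n) ℂ :=
  Matrix.of fun i j => if i < j then a ^ ((j : ℕ) - (i : ℕ)) else 0

/-- The numerical range `W(A) = {⟨A x, x⟩ : x ∈ ℂⁿ, ‖x‖ = 1}` of a complex square matrix, for the
standard inner product of `ℂⁿ`, linear in its first argument in this formula. Mathlib's
`inner ℂ` is linear in its second argument, so `⟨A x, x⟩` is written `inner ℂ x (A x)`. -/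
noncomputable def numericalRange {n : ℕ} (A : Matrix (Fin n) (Fin n) ℂ) : Set ℂ :=
  {z | ∃ x : EuclideanSpace ℂ (Fin n), ‖x‖ = 1 ∧ z = inner ℂ x (Matrix.toEuclideanLin A x)}

/-!
The matrix `J_n(a)` is obtained from `J_n(b)` by a contraction of the parameter, and numerical
ranges of `J_n` can be compared along it by the maximum principle.

For a fixed unit vector `x`, the function `g ζ = ⟨J_n(b ζ) x, x⟩` is a polynomial in `ζ` that
vanishes at `0`. For `|ζ| = 1` the matrices `J_n(b ζ)` and `J_n(b)` are unitarily similar through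
`diag (ζ ^ j)`, so `g` maps the unit circle into `W(J_n(b))`
(`inner_kmsMatrix_mul_mem_numericalRange`), while `g (a / b) = ⟨J_n(a) x, x⟩` is the given point of
`W(J_n(a))`, and `|a / b| < 1`.

If `g (a / b)` were not interior to `W(J_n(b))`, which is convex (`convex_numericalRange`) and has
`0` in its interior (`zero_mem_interior_numericalRange_kmsMatrix`), a real-linear functional would
be at most its value at `g (a / b)` on all of `W(J_n(b))`, hence on the image of the unit circle.
By the strong maximum principle (`re_mul_zero_eq_of_forall_sphere_le`) its value at `g (a / b)` is
then its value at `g 0 = 0`; but the functional is strictly smaller at the interior point `0`.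
-/

/-- The core of the Toeplitz–Hausdorff theorem, after an affine normalization of the operator: if
its quadratic form takes the values `0` and `1` at unit vectors `x` and `y`, then it takes every
value in between. -/
theorem exists_unit_inner_eq_of_zero_one {E : Type*} [NormedAddCommGroup E]
    [InnerProductSpace ℂ E] (T : E →ₗ[ℂ] E) {x y : E} (hx : ‖x‖ = 1) (hy : ‖y‖ = 1)
    (hTx : inner ℂ x (T x) = 0) (hTy : inner ℂ y (T y) = 1) {t : ℝ} (ht : t ∈ Set.Icc (0 : ℝ) 1) :
    ∃ v : E, ‖v‖ = 1 ∧ inner ℂ v (T v) = (t : ℂ) := by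
  -- A phase `c` on `y` makes the cross terms real, so the form is real on the segment `[x, c y]`.
  obtain ⟨c, hc, hcross⟩ : ∃ c : ℂ, ‖c‖ = 1 ∧
      (c * inner ℂ x (T y) + starRingEnd ℂ c * inner ℂ y (T x)).im = 0 := by
    set d : ℂ := inner ℂ x (T y) - starRingEnd ℂ (inner ℂ y (T x)) with hd
    obtain ⟨c, hc, hcd⟩ : ∃ c : ℂ, ‖c‖ = 1 ∧ ‖d‖ = c * d := Complex.exists_norm_eq_mul_self d
    refine ⟨c, hc, ?_⟩
    have h := congrArg Complex.im hcd
    simp only [hd, Complex.ofReal_im, Complex.mul_im, Complex.sub_re, Complex.sub_im,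
      Complex.conj_re, Complex.conj_im, Complex.add_im] at h ⊢
    linarith
  set r : ℝ := (c * inner ℂ x (T y) + starRingEnd ℂ c * inner ℂ y (T x)).re with hr
  have hr' : c * inner ℂ x (T y) + starRingEnd ℂ c * inner ℂ y (T x) = (r : ℂ) :=
    Complex.ext (by simp [hr]) (by simpa using hcross)
  have hcc : starRingEnd ℂ c * c = 1 := by
    rw [← Complex.normSq_eq_conj_mul_self, Complex.normSq_eq_norm_sq, hc]; simp
  let u : ℝ → E := fun s => ((1 - s : ℝ) : ℂ) • x + (s : ℂ) • c • y
  have hform (s : ℝ) : inner ℂ (u s) (T (u s)) = ((s ^ 2 + s * (1 - s) * r : ℝ) : ℂ) := by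
    simp only [u, map_add, map_smul, inner_add_left, inner_add_right, inner_smul_left,
      inner_smul_right, hTx, hTy, Complex.conj_ofReal]
    push_cast
    linear_combination (s : ℂ) ^ 2 * hcc + (s : ℂ) * (1 - s) * hr'
  have hne (s : ℝ) : u s ≠ 0 := by
    intro h
    have hxy : ((1 - s : ℝ) : ℂ) • x = -((s : ℂ) • c • y) := eq_neg_of_add_eq_zero_left h
    have h1 : inner ℂ (((1 - s : ℝ) : ℂ) • x) (T (((1 - s : ℝ) : ℂ) • x)) = (0 : ℂ) := by
      simp [hTx]
    rw [hxy] at h1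
    have h2 : (s : ℂ) ^ 2 = 0 := by
      simp only [map_neg, map_smul, inner_neg_left, inner_neg_right, inner_smul_left,
        inner_smul_right, hTy, Complex.conj_ofReal] at h1
      linear_combination h1 - (s : ℂ) ^ 2 * hcc
    have h3 : s = 0 := by simpa using h2
    subst h3
    have : x = 0 := by simpa [u] using h
    simp [this] at hx
  have hcont : Continuous u := by fun_prop
  have hh : ContinuousOn (fun s : ℝ => (s ^ 2 + s * (1 - s) * r) / ‖u s‖ ^ 2) (Set.Icc 0 1) := by
    refine Continuous.continuousOn (Continuous.div (by fun_prop) (by fun_prop) fun s => ?_)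
    exact pow_ne_zero 2 (norm_ne_zero_iff.mpr (hne s))
  have hivt := intermediate_value_Icc (zero_le_one' ℝ) hh
  have h1 : ‖u 1‖ = 1 := by simp [u, norm_smul, hc, hy]
  simp only [h1] at hivt
  obtain ⟨s, -, hs⟩ := hivt (by simpa using ht)
  have hpos : ‖u s‖ ≠ 0 := norm_ne_zero_iff.mpr (hne s)
  refine ⟨((‖u s‖⁻¹ : ℝ) : ℂ) • u s, ?_, ?_⟩
  · simp [norm_smul, hpos]
  · rw [map_smul, inner_smul_left, inner_smul_right, hform, Complex.conj_ofReal, ← hs]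
    push_cast
    field_simp

/-- The **Toeplitz–Hausdorff theorem**: the numerical range is convex. -/
theorem convex_numericalRange {n : ℕ} (A : Matrix (Fin n) (Fin n) ℂ) :
    Convex ℝ (numericalRange A) := by
  rw [convex_iff_segment_subset]
  rintro _ ⟨x, hx, rfl⟩ _ ⟨y, hy, rfl⟩
  rw [segment_eq_image']
  rintro _ ⟨t, ht, rfl⟩
  set T := Matrix.toEuclideanLin A
  set z : ℂ := inner ℂ x (T x)
  set w : ℂ := inner ℂ y (T y)
  by_cases hzw : w - z = 0
  · exact ⟨x, hx, by simp [hzw, z, T]⟩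
  let S : EuclideanSpace ℂ (Fin n) →ₗ[ℂ] EuclideanSpace ℂ (Fin n) :=
    (w - z)⁻¹ • (T - z • LinearMap.id)
  have hS (v : EuclideanSpace ℂ (Fin n)) (hv : ‖v‖ = 1) :
      inner ℂ v (S v) = (w - z)⁻¹ * (inner ℂ v (T v) - z) := by
    simp [S, inner_self_eq_norm_sq_to_K, hv]
  obtain ⟨v, hv, hvt⟩ := exists_unit_inner_eq_of_zero_one S hx hy
    (by rw [hS x hx]; simp [z]) (by rw [hS y hy]; exact inv_mul_cancel₀ hzw) ht
  refine ⟨v, hv, ?_⟩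
  rw [hS v hv, inv_mul_eq_iff_eq_mul₀ hzw] at hvt
  simp only [Complex.real_smul]
  linear_combination -hvt

theorem inner_toEuclideanLin_kmsMatrix {n : ℕ} (a : ℂ) (x : EuclideanSpace ℂ (Fin n)) :
    inner ℂ x (Matrix.toEuclideanLin (kmsMatrix n a) x) =
      ∑ i : Fin n, ∑ j : Fin n, if i < j then a ^ ((j : ℕ) - (i : ℕ)) * (x j * starRingEnd ℂ (x i)) else 0 := by
  simp [PiLp.inner_apply, Matrix.toEuclideanLin, Matrix.mulVec, dotProduct, kmsMatrix,
    Finset.sum_mul, ite_mul, mul_assoc]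

/-- The vector `(ζ ^ j x_j)_j` carries the rotation `a ↦ a ζ` of the parameter: for `|ζ| = 1` the
matrices `J_n(a ζ)` and `J_n(a)` are unitarily similar through `diag (ζ ^ j)`. -/
theorem inner_kmsMatrix_mul_mem_numericalRange {n : ℕ} (a : ℂ) {ζ : ℂ} (hζ : ‖ζ‖ = 1)
    {x : EuclideanSpace ℂ (Fin n)} (hx : ‖x‖ = 1) :
    inner ℂ x (Matrix.toEuclideanLin (kmsMatrix n (a * ζ)) x) ∈ numericalRange (kmsMatrix n a) := by
  refine ⟨WithLp.toLp 2 fun j => ζ ^ (j : ℕ) * x j, ?_, ?_⟩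
  · rw [← hx, EuclideanSpace.norm_eq, EuclideanSpace.norm_eq]
    simp [hζ]
  · rw [inner_toEuclideanLin_kmsMatrix, inner_toEuclideanLin_kmsMatrix]
    refine Finset.sum_congr rfl fun i _ => Finset.sum_congr rfl fun j _ => ?_
    split_ifs with hij
    · have hζζ : ζ ^ (i : ℕ) * starRingEnd ℂ ζ ^ (i : ℕ) = 1 := by
        rw [← mul_pow, Complex.mul_conj, Complex.normSq_eq_norm_sq, hζ]; simp
      have hpow : ζ ^ (j : ℕ) = ζ ^ ((j : ℕ) - (i : ℕ)) * ζ ^ (i : ℕ) := by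
        rw [← pow_add, Nat.sub_add_cancel (le_of_lt hij)]
      simp only [map_mul, map_pow, hpow]
      linear_combination
        -(a ^ ((j : ℕ) - (i : ℕ)) * ζ ^ ((j : ℕ) - (i : ℕ)) * x j * starRingEnd ℂ (x i)) * hζζ
    · rfl

/-- The compression to the first two coordinates is a nilpotent block whose numerical range is the
disc of radius `‖a‖ / 2`. -/
theorem zero_mem_interior_numericalRange_kmsMatrix {n : ℕ} (hn : 2 ≤ n) {a : ℂ} (ha : a ≠ 0) :
    (0 : ℂ) ∈ interior (numericalRange (kmsMatrix n a)) := by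
  have hpos : 0 < ‖a‖ := norm_pos_iff.mpr ha
  have hsphere : Metric.sphere (0 : ℂ) (‖a‖ / 2) ⊆ numericalRange (kmsMatrix n a) := by
    intro v hv
    rw [mem_sphere_zero_iff_norm] at hv
    let i₀ : Fin n := ⟨0, by omega⟩
    let i₁ : Fin n := ⟨1, by omega⟩
    have h01 : i₀ ≠ i₁ := by simp [i₀, i₁]
    have hs : ((√2 : ℝ) : ℂ) ^ 2 = 2 := by
      rw [← Complex.ofReal_pow, Real.sq_sqrt zero_le_two]; simp
    have hs0 : ((√2 : ℝ) : ℂ) ≠ 0 := by simp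
    -- `ȳ₀ y₁ = v / a` with both moduli equal to `1 / √2`
    let y : EuclideanSpace ℂ (Fin n) := WithLp.toLp 2 fun j =>
      if j = i₀ then ((√2 : ℝ) : ℂ)⁻¹ else if j = i₁ then (√2 : ℝ) * (v / a) else 0
    have hy0 : y i₀ = ((√2 : ℝ) : ℂ)⁻¹ := by simp [y]
    have hy1 : y i₁ = (√2 : ℝ) * (v / a) := by simp [y, h01.symm]
    have hy (j : Fin n) (hj : j ≠ i₀ ∧ j ≠ i₁) : y j = 0 := by simp [y, hj.1, hj.2]
    refine ⟨y, ?_, ?_⟩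
    · rw [EuclideanSpace.norm_eq, Fintype.sum_eq_add i₀ i₁ h01 fun j hj => by simp [hy j hj],
        hy0, hy1, Real.sqrt_eq_one]
      simp only [norm_inv, norm_mul, norm_div, Complex.norm_real, hv, Real.norm_eq_abs, inv_pow,
        mul_pow, div_pow, sq_abs, Real.sq_sqrt zero_le_two]
      field_simp
      norm_num
    · rw [inner_toEuclideanLin_kmsMatrix]
      rw [Fintype.sum_eq_single i₀, Fintype.sum_eq_single i₁]
      · rw [if_pos (by simp [i₀, i₁, Fin.lt_def]), hy0, hy1]
        simp only [i₀, i₁, Nat.sub_zero, pow_one, map_inv₀, Complex.conj_ofReal]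
        field_simp
      · intro j hj
        by_cases hj0 : j = i₀
        · simp [hj0]
        · simp [hy j ⟨hj0, hj⟩]
      · intro i hi
        refine Finset.sum_eq_zero fun j _ => ?_
        split_ifs with hij
        · by_cases hi1 : i = i₁
          · have h0 : j ≠ i₀ := by rintro rfl; simp [i₀, Fin.lt_def] at hij
            have h1 : j ≠ i₁ := by rintro rfl; exact absurd hij (by simp [hi1])
            simp [hy j ⟨h0, h1⟩]
          · simp [hy i ⟨hi, hi1⟩]
        · rfl
  have hball : Metric.closedBall (0 : ℂ) (‖a‖ / 2) ⊆ numericalRange (kmsMatrix n a) := by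
    rw [← convexHull_sphere_eq_closedBall (0 : ℂ) (by positivity)]
    exact convexHull_min hsphere (convex_numericalRange _)
  exact mem_interior_iff_mem_nhds.mpr
    (Filter.mem_of_superset (Metric.closedBall_mem_nhds _ (by positivity)) hball)

/-- The strong maximum principle, in the form used here: if a real-linear functional of a
holomorphic function on the unit disc is bounded on the unit circle by its value at an interior
point, then it has that value at the centre. -/
theorem re_mul_zero_eq_of_forall_sphere_le {g : ℂ → ℂ} (hg : Differentiable ℂ g) (w : ℂ) {t : ℂ}
    (ht : ‖t‖ < 1) (hle : ∀ ζ : ℂ, ‖ζ‖ = 1 → (w * g ζ).re ≤ (w * g t).re) :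
    (w * g 0).re = (w * g t).re := by
  let h : ℂ → ℂ := fun ζ => Complex.exp (w * g ζ)
  have hd : Differentiable ℂ h := by fun_prop
  have hmax : ∀ ζ ∈ closure (Metric.ball (0 : ℂ) 1), ‖h ζ‖ ≤ ‖h t‖ := fun ζ hζ =>
    Complex.norm_le_of_forall_mem_frontier_norm_le Metric.isBounded_ball hd.diffContOnCl
      (fun ξ hξ => by
        rw [frontier_ball (0 : ℂ) one_ne_zero, mem_sphere_zero_iff_norm] at hξ
        simpa [h, Complex.norm_exp] using hle ξ hξ) hζ
  have heq := Complex.norm_eqOn_of_isPreconnected_of_isMaxOn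
    (convex_ball (0 : ℂ) 1).isPreconnected Metric.isOpen_ball hd.differentiableOn
    (mem_ball_zero_iff.mpr ht) (fun ζ hζ => hmax ζ (subset_closure hζ))
    (Metric.mem_ball_self one_pos)
  simpa [h, Complex.norm_exp] using heq

theorem proposition3p7 (n : ℕ) (hn : 2 ≤ n) (a b : ℂ) (hab : ‖a‖ < ‖b‖) :
    numericalRange (kmsMatrix n a) ⊆ interior (numericalRange (kmsMatrix n b)) := by
  have hbpos : 0 < ‖b‖ := (norm_nonneg a).trans_lt hab
  have hb : b ≠ 0 := norm_pos_iff.mp hbpos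
  rintro z ⟨x, hx, rfl⟩
  by_contra hz
  let g : ℂ → ℂ := fun ζ => inner ℂ x (Matrix.toEuclideanLin (kmsMatrix n (b * ζ)) x)
  have hg : Differentiable ℂ g := by
    simp only [g, inner_toEuclideanLin_kmsMatrix]
    refine Differentiable.fun_sum fun i _ => Differentiable.fun_sum fun j _ => ?_
    split_ifs <;> fun_prop
  have hg0 : g 0 = 0 := by
    simp only [g, inner_toEuclideanLin_kmsMatrix]
    refine Finset.sum_eq_zero fun i _ => Finset.sum_eq_zero fun j _ => ?_
    split_ifs with hij
    · rw [mul_zero, zero_pow (Nat.sub_ne_zero_of_lt hij), zero_mul]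
    · rfl
  have hgt : g (a / b) = inner ℂ x (Matrix.toEuclideanLin (kmsMatrix n a) x) := by
    simp only [g, mul_div_cancel₀ a hb]
  rw [← hgt] at hz
  have hconv := convex_numericalRange (kmsMatrix n b)
  have h0 := zero_mem_interior_numericalRange_kmsMatrix hn hb
  obtain ⟨f, hf⟩ := geometric_hahn_banach_open_point hconv.interior isOpen_interior hz
  have hle : ∀ y ∈ numericalRange (kmsMatrix n b), f y ≤ f (g (a / b)) := by
    intro y hy
    have hy' : y ∈ closure (interior (numericalRange (kmsMatrix n b))) := by
      rw [hconv.closure_interior_eq_closure_of_nonempty_interior ⟨0, h0⟩]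
      exact subset_closure hy
    exact closure_minimal (fun v hv => (hf v hv).le)
      (isClosed_le f.continuous continuous_const) hy'
  let w : ℂ := ⟨f 1, -f Complex.I⟩
  have hw (v : ℂ) : f v = (w * v).re := by
    have hv : v = v.re • (1 : ℂ) + v.im • Complex.I := by
      simp [Complex.re_add_im]
    conv_lhs => rw [hv]
    simp only [map_add, map_smul, smul_eq_mul, Complex.mul_re, w]
    ring
  have hkey := re_mul_zero_eq_of_forall_sphere_le hg w (t := a / b)
    (by rw [norm_div, div_lt_one hbpos]; exact hab)
    (fun ζ hζ => by
      rw [← hw, ← hw]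
      exact hle _ (inner_kmsMatrix_mul_mem_numericalRange b hζ hx))
  have hlt := hf 0 h0
  rw [hw, hw, ← hkey, hg0] at hlt
  exact lt_irrefl _ hlt
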